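/- Let $\mathbb K$ be a field and $R=\mathbb K[x_1,\dots,x_n,y_1,\dots,y_n]$ with its standard grading. For a (simple) graph $G$ with vertex set $[n]=\{1,\dots,n\}$ put $f_{ij}=x_iy_j-x_jy_i$ and let $J_G=(f_{ij} : \{i,j\}\in E(G),\ i<j)\subset R$ be its binomial edge ideal. Let $\mathrm{in}_{\mathrm{lex}}(I)$ denote the ideal generated by the leading monomials of the nonzero elements of $I$ for the lexicographic order with $x_1>\dots>x_n>y_1>\dots>y_n$. The labeling of $G$ is called closed if for all edges $\{i,j\}\neq\{k,l\}$ with $i<j$, $k<l$ one has $\{j,l\}\in E(G)$ whenever $i=k$, and $\{i,k\}\in E(G)$ whenever $j=l$; $G$ is called closed if its vertices can be relabeled by $1,\dots,n$ so that the labeling is closed. Let $S=R[T_{ij} : \{i,j\}\in E(G),\ i<j]$, bigraded by $\deg x_i=\deg y_i=(0,1)$, $\deg T_{ij}=(1,2)$. Let $L$ be the kernel of the $R$-algebra map from $S$ to the Rees algebra $\mathcal R(J_G)=\bigoplus_{i\ge 0}J_G^iT^i\subset R[T]$ with $T_{ij}\mapsto f_{ij}T$, and let $L'$ be the kernel of the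 $R$-algebra map $S\to\mathcal R(\mathrm{in}_{\mathrm{lex}}J_G)$ with $T_{ij}\mapsto \mathrm{in}_{\mathrm{lex}}(f_{ij})T$. Write $L_{(m,-)}$ for the $R$-module of elements of $L$ that are homogeneous of degree $m$ in the variables $T_{ij}$, graded by $L_{(m,-)}=\bigoplus_b L_{(m,b)}$, and similarly for $L'$. For a homogeneous ideal $I$ of $R$ let $\Omega^1(I)$ be the kernel of $F_0\to I$, where $F_0\to I$ is the augmentation of a minimal graded free resolution of $I$; it is a graded $R$-module, unique up to graded isomorphism. Suppose that $G$ is closed and has no induced subgraph isomorphic to the complete graph $K_4$. Then for every integer $m\ge 1$ there is an isomorphism of graded $R$-modules $$L_{(m,-)}\cong\Omega^1(J_G^m),$$ and, if $G$ carries a closed labeling (as can always be achieved by relabeling the vertices), also an isomorphism of graded $R$-modules $$L'_{(m,-)}\cong\Omega^1\big((\mathrm{in}_{\mathrm{lex}}J_G)^m\big).$$ -/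

import Mathlib

open MvPolynomial

noncomputable section

namespace BinomialEdge

/-- The labeling of the vertices by `1, …, n` is closed: for edges `{i,j}`, `{k,l}` with `i < j`,
`k < l`, if `i = k` (and `j ≠ l`) then `{j,l}` is an edge, and if `j = l` (and `i ≠ k`) then `{i,k}`
is an edge. -/
def IsClosedLabeling {n : ℕ} (G : SimpleGraph (Fin n)) : Prop :=
  ∀ i j k l : Fin n, G.Adj i j → G.Adj k l → i < j → k < l →
    (i = k → j ≠ l → G.Adj j l) ∧ (j = l → i ≠ k → G.Adj i k)

/-- A graph is closed if it has a closed labeling of its vertices, that is, if it is isomorphic to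
a graph on `Fin n` whose labeling is closed. -/
def IsClosedGraph {n : ℕ} (G : SimpleGraph (Fin n)) : Prop :=
  ∃ H : SimpleGraph (Fin n), Nonempty (G ≃g H) ∧ IsClosedLabeling H

/-- The variables of `R`, ordered so that the lexicographic order has
`x_1 > ⋯ > x_n > y_1 > ⋯ > y_n`. -/
abbrev Var (n : ℕ) : Type := Fin n ⊕ₗ Fin n

/-- `R = K[x_1, …, x_n, y_1, …, y_n]`. -/
abbrev R (K : Type*) [Field K] (n : ℕ) : Type _ := MvPolynomial (Var n) K

/-- The edges `(i, j)` of `G`, written with `i < j`. -/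
abbrev Edge {n : ℕ} (G : SimpleGraph (Fin n)) : Type :=
  {p : Fin n × Fin n // p.1 < p.2 ∧ G.Adj p.1 p.2}

section

variable (K : Type*) [Field K] {n : ℕ}

def x (i : Fin n) : R K n := X (Sum.inlₗ i)

def y (i : Fin n) : R K n := X (Sum.inrₗ i)

/-- `f_{ij} = x_i y_j - x_j y_i`. -/
def f (i j : Fin n) : R K n := x K i * y K j - x K j * y K i

/-- The generators of the binomial edge ideal, indexed by the edges. -/
def edgeGen (G : SimpleGraph (Fin n)) (e : Edge G) : R K n := f K e.1.1 e.1.2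

/-- The binomial edge ideal `J_G`. -/
def J (G : SimpleGraph (Fin n)) : Ideal (R K n) := Ideal.span (Set.range (edgeGen K G))

end

section

variable {K : Type*} [Field K] {n : ℕ}

/-- The leading monomial of a nonzero polynomial in the lexicographic order. -/
def leadMonomial (p : R K n) : R K n := monomial (MonomialOrder.lex.degree p) 1

/-- The lexicographic initial ideal. -/
def initialIdeal (I : Ideal (R K n)) : Ideal (R K n) :=
  Ideal.span {q | ∃ p ∈ I, p ≠ 0 ∧ q = leadMonomial p}

variable (K)

/-- `in_lex(f_{ij})`, indexed by the edges. -/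
def edgeInitial (G : SimpleGraph (Fin n)) (e : Edge G) : R K n := leadMonomial (edgeGen K G e)

theorem edgeGen_mem (G : SimpleGraph (Fin n)) (e : Edge G) : edgeGen K G e ∈ J K G :=
  Ideal.subset_span ⟨e, rfl⟩

theorem edgeGen_ne_zero (G : SimpleGraph (Fin n)) (e : Edge G) : edgeGen K G e ≠ 0 := by
  intro h
  have h2 := congrArg (eval (fun v : Var n =>
    if v = Sum.inlₗ e.1.1 ∨ v = Sum.inrₗ e.1.2 then (1 : K) else 0)) h
  have hne : e.1.2 ≠ e.1.1 := ne_of_gt e.2.1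
  simp [edgeGen, f, x, y, hne] at h2

theorem edgeInitial_mem (G : SimpleGraph (Fin n)) (e : Edge G) :
    edgeInitial K G e ∈ initialIdeal (J K G) :=
  Ideal.subset_span ⟨_, edgeGen_mem K G e, edgeGen_ne_zero K G e, rfl⟩

end

section

variable {K : Type*} [Field K] {n : ℕ}

/-- `p` lies in the degree `b` component of the shifted module `R(-j)`, that is, `p ∈ R_{b-j}`. -/
def InShift (j b : ℕ) (p : R K n) : Prop := ∀ d ∈ p.support, d.degree + j = b

/-- The map `φ : R[T_e] → 𝓡(I)`, `T_e ↦ g_e T`, for a family of elements `g_e` of `I`. -/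
def reesMap {ι : Type*} (I : Ideal (R K n)) (g : ι → R K n) (hg : ∀ e, g e ∈ I) :
    MvPolynomial ι (R K n) →ₐ[R K n] reesAlgebra I :=
  aeval fun e => ⟨Polynomial.monomial 1 (g e), by
    rw [reesAlgebra.monomial_mem, pow_one]; exact hg e⟩

/-- The ideal of relations `L = ker φ`. -/
def reesRelations {ι : Type*} (I : Ideal (R K n)) (g : ι → R K n) (hg : ∀ e, g e ∈ I) :
    Ideal (MvPolynomial ι (R K n)) :=
  RingHom.ker (reesMap I g hg)

/-- `L_{(m,-)}`: the elements of `L` that are homogeneous of degree `m` in the variables `T_e`. -/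
def relationsOfDegree {ι : Type*} (L : Ideal (MvPolynomial ι (R K n))) (m : ℕ) :
    Submodule (R K n) (MvPolynomial ι (R K n)) :=
  L.restrictScalars (R K n) ⊓ homogeneousSubmodule ι (R K n) m

/-- `F` is bihomogeneous of bidegree `(a, b)`, where `deg T_e = (1, 2)` and
`deg x_i = deg y_i = (0, 1)`. -/
def HasBidegree {ι : Type*} (F : MvPolynomial ι (R K n)) (a b : ℕ) : Prop :=
  ∀ α ∈ F.support, α.degree = a ∧ InShift (2 * a) b (F.coeff α)

/-- The start of a minimal graded free resolution of the ideal `I`: a surjection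
`⨁_i R(-deg i) → I`, `e_i ↦ gen i`, preserving degrees, with kernel contained in
`𝔪 · ⨁_i R(-deg i)`. -/
structure MinimalCover (I : Ideal (R K n)) where
  rank : ℕ
  deg : Fin rank → ℕ
  gen : Fin rank → R K n
  homogeneous : ∀ i, (gen i).IsHomogeneous (deg i)
  span_eq : Ideal.span (Set.range gen) = I
  minimal : ∀ v : Fin rank → R K n, ∑ i, v i * gen i = 0 →
    ∀ i, v i ∈ Ideal.span (Set.range (X : Var n → R K n))

/-- The first syzygy module `Ω¹(I)`: the kernel of `⨁_i R(-deg i) → I`. -/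
def MinimalCover.syzygy {I : Ideal (R K n)} (P : MinimalCover I) :
    Submodule (R K n) (Fin P.rank → R K n) :=
  LinearMap.ker (Fintype.linearCombination (R K n) P.gen)

/-- Membership in the degree `b` component of `⨁_i R(-deg i)`. -/
def MinimalCover.HasDegree {I : Ideal (R K n)} (P : MinimalCover I) (v : Fin P.rank → R K n)
    (b : ℕ) : Prop :=
  ∀ i, InShift (P.deg i) b (v i)

/-- `L_{(m,-)} ≅ Ω¹(I)` as graded `R`-modules. The module `Ω¹(I)` is determined up to graded
isomorphism by `I`; the statement is that a minimal cover of `I` exists and that for every minimal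
cover there is an `R`-linear bijection matching `L_{(m,b)}` with `Ω¹(I)_b` for all `b`. -/
def GradedIsoSyzygy {ι : Type*} (L : Ideal (MvPolynomial ι (R K n))) (m : ℕ)
    (I : Ideal (R K n)) : Prop :=
  Nonempty (MinimalCover I) ∧
  ∀ P : MinimalCover I, ∃ e : relationsOfDegree L m ≃ₗ[R K n] P.syzygy,
    ∀ (F : relationsOfDegree L m) (b : ℕ),
      HasBidegree (F : MvPolynomial ι (R K n)) m b ↔ P.HasDegree (e F : Fin P.rank → R K n) b

end

end BinomialEdge

end

open MvPolynomial

noncomputable section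

namespace BinomialEdge

/-! ### Minimal covers of ideals generated in a single degree. -/

section Cover

variable {K : Type*} [Field K] {n : ℕ}

/-! A relation of degree `m` in the `T_e` is the same thing as a syzygy of the family of all
`m`-fold products of the generators (`relationsEquivSyzygies`). These products are forms of one
degree `2m`, so if they are linearly independent over `K` they generate the `m`-th power minimally,
and their syzygies are `Ω¹` (`exists_ker_equiv_syzygy`). Everything thus reduces to linear
independence of the products.

For a closed labeling the leading monomials of the generators are the `x_i y_j`. A cycle in the
bipartite graph formed by these monomials would, at its smallest `x`-vertex, force a `K_4`
(`weight_eq_zero`). Hence distinct products have distinct leading monomials and are independent. For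
`J_G` itself the labeling need not be closed, and independence is pulled back along a relabeling.
For the initial ideal one also needs that the `x_i y_j` generate it; this follows from confluence of
the rewriting `x_i y_j → x_j y_i` (`step_diamond`, `exists_step_of_mem_J`). -/

theorem homogeneousComponent_mul_of_isHomogeneous {σ : Type*} {p q : MvPolynomial σ K} {e : ℕ}
    (hq : q.IsHomogeneous e) (d : ℕ) :
    homogeneousComponent d (p * q) =
      if e ≤ d then homogeneousComponent (d - e) p * q else 0 := by
  have hterm (i : ℕ) : homogeneousComponent d (homogeneousComponent i p * q) =
      if d = i + e then homogeneousComponent i p * q else 0 :=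
    homogeneousComponent_of_mem ((homogeneousComponent_isHomogeneous i p).mul hq)
  have hd : homogeneousComponent d (p * q) =
      ∑ i ∈ Finset.range (p.totalDegree + 1),
        if d = i + e then homogeneousComponent i p * q else 0 := by
    conv_lhs => rw [← sum_homogeneousComponent p, Finset.sum_mul, map_sum]
    exact Finset.sum_congr rfl fun i _ => hterm i
  rw [hd]
  split_ifs with h
  · rw [Finset.sum_eq_single (d - e)]
    · rw [if_pos (by omega)]
    · intro i _ hi
      rw [if_neg (by omega)]
    · intro hi
      rw [Finset.mem_range, not_lt] at hi
      rw [if_pos (by omega), homogeneousComponent_eq_zero _ _ (by omega), zero_mul]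
  · exact Finset.sum_eq_zero fun i _ => if_neg (by omega)

theorem homogeneousComponent_mul_self {σ : Type*} {p q : MvPolynomial σ K} {d : ℕ}
    (hq : q.IsHomogeneous d) : homogeneousComponent d (p * q) = p.coeff 0 • q := by
  rw [homogeneousComponent_mul_of_isHomogeneous hq, if_pos le_rfl, Nat.sub_self,
    homogeneousComponent_zero, smul_eq_C_mul]

theorem mem_span_range_X_iff {σ : Type*} {p : MvPolynomial σ K} :
    p ∈ Ideal.span (Set.range (X : σ → MvPolynomial σ K)) ↔ p.coeff 0 = 0 := by
  rw [← Set.image_univ, mem_ideal_span_X_image]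
  constructor
  · intro h
    by_contra h0
    obtain ⟨i, -, hi⟩ := h 0 (mem_support_iff.2 h0)
    exact hi rfl
  · intro h d hd
    by_contra! hc
    have : d = 0 := Finsupp.ext fun i => hc i (Set.mem_univ i)
    exact mem_support_iff.1 hd (this ▸ h)

variable {κ : Type*} [Fintype κ] {h : κ → R K n} {D : ℕ}

/-- An `R`-linear relation between `K`-linearly independent forms of the same degree has
coefficients without constant term. -/
theorem coeff_zero_of_relation (hD : ∀ k, (h k).IsHomogeneous D) (hli : LinearIndependent K h)
    {v : κ → R K n} (hv : ∑ k, v k * h k = 0) (k : κ) : (v k).coeff 0 = 0 := by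
  have h1 := congrArg (homogeneousComponent D) hv
  rw [map_sum, map_zero] at h1
  simp only [homogeneousComponent_mul_self (hD _)] at h1
  exact Fintype.linearIndependent_iff.1 hli _ h1 k

/-- In degree `D` only the constant terms of the coefficients in an `R`-linear combination survive.
-/
theorem mem_span_of_isHomogeneous (hD : ∀ k, (h k).IsHomogeneous D) {q : R K n}
    (hq : q.IsHomogeneous D) (hqI : q ∈ Ideal.span (Set.range h)) :
    q ∈ Submodule.span K (Set.range h) := by
  obtain ⟨a, rfl⟩ := Ideal.mem_span_range_iff_exists_fun.1 hqI
  have h1 : homogeneousComponent D (∑ k, a k * h k) = ∑ k, a k * h k := by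
    rw [homogeneousComponent_of_mem hq, if_pos rfl]
  rw [← h1, map_sum]
  simp only [homogeneousComponent_mul_self (hD _)]
  exact Submodule.sum_mem _ fun k _ => Submodule.smul_mem _ _ (Submodule.subset_span ⟨k, rfl⟩)

/-- Linearly independent forms of the same degree are a minimal system of generators. -/
def MinimalCover.ofLinearIndependent (hD : ∀ k, (h k).IsHomogeneous D)
    (hli : LinearIndependent K h) : MinimalCover (Ideal.span (Set.range h)) where
  rank := Fintype.card κ
  deg _ := D
  gen i := h ((Fintype.equivFin κ).symm i)
  homogeneous _ := hD _
  span_eq := congrArg _ ((Fintype.equivFin κ).symm.surjective.range_comp h)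
  minimal _ hv i := mem_span_range_X_iff.2 <|
    coeff_zero_of_relation (fun _ => hD _)
      (hli.comp _ (Fintype.equivFin κ).symm.injective) hv i

theorem MinimalCover.coeff_zero {I : Ideal (R K n)} (P : MinimalCover I)
    {v : Fin P.rank → R K n} (hv : ∑ i, v i * P.gen i = 0) (i : Fin P.rank) :
    (v i).coeff 0 = 0 :=
  mem_span_range_X_iff.1 (P.minimal v hv i)

theorem MinimalCover.gen_mem {I : Ideal (R K n)} (P : MinimalCover I) (i : Fin P.rank) :
    P.gen i ∈ I :=
  P.span_eq.le (Ideal.subset_span ⟨i, rfl⟩)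

/-- No generator of a minimal cover is a combination of the others. -/
theorem MinimalCover.gen_ne_sum {I : Ideal (R K n)} (P : MinimalCover I) (i : Fin P.rank)
    (c : Fin P.rank → R K n) (hc : c i = 0) : P.gen i ≠ ∑ j, c j * P.gen j := by
  intro heq
  -- The relation obtained has coefficient `-1` at `i`, which minimality forbids.
  have := P.coeff_zero (v := fun j => c j - if j = i then 1 else 0)
    (by simp [sub_mul, Finset.sum_sub_distrib, ← heq]) i
  simp [hc] at this

theorem MinimalCover.linearIndependent {I : Ideal (R K n)} (P : MinimalCover I) :
    LinearIndependent K P.gen := by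
  rw [Fintype.linearIndependent_iff]
  intro c hc i
  have := P.coeff_zero (v := fun j => C (c j)) (by simpa [smul_eq_C_mul] using hc) i
  simpa using this

/-- If `I` is generated in degree `D`, so is every minimal cover of `I`. -/
theorem MinimalCover.deg_eq (hD : ∀ k, (h k).IsHomogeneous D)
    (P : MinimalCover (Ideal.span (Set.range h))) (i : Fin P.rank) : P.deg i = D := by
  rcases lt_trichotomy (P.deg i) D with hlt | heq | hgt
  · exfalso
    -- The ideal has no nonzero element of degree below `D`, so the generator would be zero, the
    -- empty combination.
    obtain ⟨a, ha⟩ := Ideal.mem_span_range_iff_exists_fun.1 (P.gen_mem i)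
    have h1 := congrArg (homogeneousComponent (P.deg i)) ha
    rw [homogeneousComponent_of_mem (P.homogeneous i), if_pos rfl, map_sum] at h1
    simp only [homogeneousComponent_mul_of_isHomogeneous (hD _), if_neg (not_le.2 hlt),
      Finset.sum_const_zero] at h1
    exact P.gen_ne_sum i 0 rfl (by simpa using h1.symm)
  · exact heq
  · exfalso
    -- For degree reasons each `h k` can be written without generator `i`. Since the `h k` generate
    -- the ideal, that generator would be redundant.
    have hk (k : κ) : ∃ c : Fin P.rank → R K n, c i = 0 ∧ ∑ j, c j * P.gen j = h k := by
      have hmem : h k ∈ Ideal.span (Set.range P.gen) := by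
        rw [P.span_eq]
        exact Ideal.subset_span ⟨k, rfl⟩
      obtain ⟨a, ha⟩ := Ideal.mem_span_range_iff_exists_fun.1 hmem
      refine ⟨fun j => if P.deg j ≤ D then homogeneousComponent (D - P.deg j) (a j) else 0,
        if_neg (not_le.2 hgt), ?_⟩
      have h1 := congrArg (homogeneousComponent D) ha
      rw [homogeneousComponent_of_mem (hD k), if_pos rfl, map_sum] at h1
      simpa only [homogeneousComponent_mul_of_isHomogeneous (P.homogeneous _), ite_mul,
        zero_mul] using h1
    choose c hci hc using hk
    obtain ⟨a, ha⟩ := Ideal.mem_span_range_iff_exists_fun.1 (P.gen_mem i)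
    refine P.gen_ne_sum i (fun j => ∑ k, a k * c k j) (by simp [hci]) ?_
    rw [← ha]
    simp only [Finset.sum_mul]
    rw [Finset.sum_comm]
    refine Finset.sum_congr rfl fun k _ => ?_
    rw [← hc k, Finset.mul_sum]
    simp only [mul_assoc]

theorem InShift.sum_C_mul {ι : Type*} (s : Finset ι) {j b : ℕ} (c : ι → K) {p : ι → R K n}
    (hp : ∀ i, InShift j b (p i)) : InShift j b (∑ i ∈ s, p i * C (c i)) := by
  classical
  intro d hd
  by_contra hne
  refine mem_support_iff.1 hd ?_
  rw [coeff_sum]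
  refine Finset.sum_eq_zero fun i _ => ?_
  rw [mul_comm, coeff_C_mul]
  have : (p i).coeff d = 0 := by
    by_contra h0
    exact hne (hp i d (mem_support_iff.2 h0))
  rw [this, mul_zero]

/-- Applied in both directions, this makes the two transition matrices mutually inverse without
first comparing the sizes of the families. -/
theorem mul_eq_one_of_change_of_basis {V : Type*} [AddCommGroup V] [Module K V] {ι : Type*}
    [Fintype ι] [DecidableEq κ] {u : κ → V} {w : ι → V} (hu : LinearIndependent K u)
    {A : Matrix κ ι K} {B : Matrix ι κ K} (hA : ∀ k, ∑ i, A k i • w i = u k)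
    (hB : ∀ i, ∑ k, B i k • u k = w i) : A * B = 1 := by
  ext k l
  have h1 : ∑ l, ((A * B) k l - (1 : Matrix κ κ K) k l) • u l = 0 := by
    simp only [sub_smul, Finset.sum_sub_distrib, Matrix.mul_apply, Matrix.one_apply, ite_smul,
      one_smul, zero_smul, Finset.sum_ite_eq, Finset.mem_univ, if_true, Finset.sum_smul, mul_smul]
    rw [Finset.sum_comm]
    simp only [← Finset.smul_sum, hB, hA, sub_self]
  exact sub_eq_zero.1 (Fintype.linearIndependent_iff.1 hu _ h1 l)

/-- The syzygies of linearly independent forms of degree `D` are graded isomorphic to the first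
syzygy module of the ideal which they generate. -/
theorem exists_ker_equiv_syzygy (hD : ∀ k, (h k).IsHomogeneous D)
    (hli : LinearIndependent K h) (P : MinimalCover (Ideal.span (Set.range h))) :
    ∃ e : LinearMap.ker (Fintype.linearCombination (R K n) h) ≃ₗ[R K n] P.syzygy,
      ∀ (v : LinearMap.ker (Fintype.linearCombination (R K n) h)) (b : ℕ),
        (∀ k, InShift D b ((v : κ → R K n) k)) ↔
        P.HasDegree (e v : Fin P.rank → R K n) b := by
  classical
  have hdeg := P.deg_eq hD
  have hPD (i : Fin P.rank) : (P.gen i).IsHomogeneous D := hdeg i ▸ P.homogeneous i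
  choose A hA using fun k => (Submodule.mem_span_range_iff_exists_fun K).1
    (mem_span_of_isHomogeneous hPD (hD k) (P.span_eq.ge (Ideal.subset_span ⟨k, rfl⟩)))
  choose B hB using fun i => (Submodule.mem_span_range_iff_exists_fun K).1
    (mem_span_of_isHomogeneous hD (hPD i) (P.gen_mem i))
  have hAB := mul_eq_one_of_change_of_basis hli (A := A) (B := B) hA hB
  have hBA := mul_eq_one_of_change_of_basis P.linearIndependent (A := B) (B := A) hB hA
  let A' : Matrix κ (Fin P.rank) (R K n) := Matrix.map A C
  let B' : Matrix (Fin P.rank) κ (R K n) := Matrix.map B C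
  have hAB' : A' * B' = 1 := by
    refine (Matrix.map_mul (L := Matrix.of A) (M := Matrix.of B) (f := C)).symm.trans ?_
    exact (congrArg (fun M => Matrix.map M C) hAB).trans
      (Matrix.map_one _ (map_zero C) (map_one C))
  have hBA' : B' * A' = 1 := by
    refine (Matrix.map_mul (L := Matrix.of B) (M := Matrix.of A) (f := C)).symm.trans ?_
    exact (congrArg (fun M => Matrix.map M C) hBA).trans
      (Matrix.map_one _ (map_zero C) (map_one C))
  -- Coefficient vectors are rows, so `E v` is `v * A'`. The entries are constants, hence `E` and
  -- its inverse preserve degrees.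
  let E : (κ → R K n) ≃ₗ[R K n] (Fin P.rank → R K n) :=
    Matrix.toLinearEquivRight'OfInv hBA' hAB'
  have hE (v : κ → R K n) (i : Fin P.rank) : E v i = ∑ k, v k * C (A k i) := rfl
  have hE' (v : Fin P.rank → R K n) (k : κ) : E.symm v k = ∑ i, v i * C (B i k) := rfl
  have hEl (v : κ → R K n) :
      Fintype.linearCombination (R K n) P.gen (E v) = Fintype.linearCombination (R K n) h v := by
    simp only [Fintype.linearCombination_apply, hE, smul_eq_mul, Finset.sum_mul]
    rw [Finset.sum_comm]
    refine Finset.sum_congr rfl fun k _ => ?_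
    simp only [← hA k, Finset.mul_sum, smul_eq_C_mul, mul_assoc]
  have hmap : (LinearMap.ker (Fintype.linearCombination (R K n) h)).map
      (E : (κ → R K n) →ₗ[R K n] (Fin P.rank → R K n)) = P.syzygy := by
    ext w
    rw [Submodule.map_equiv_eq_comap_symm]
    simp only [Submodule.mem_comap, LinearMap.mem_ker, MinimalCover.syzygy]
    rw [← hEl]
    simp
  refine ⟨E.ofSubmodules _ _ hmap, fun v b => ?_⟩
  simp only [MinimalCover.HasDegree, hdeg, LinearEquiv.ofSubmodules_apply]
  constructor
  · intro hv i
    rw [hE]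
    exact InShift.sum_C_mul _ _ hv
  · intro hv k
    rw [← E.symm_apply_apply (v : κ → R K n), hE']
    exact InShift.sum_C_mul _ _ hv

end Cover

/-! ### Relations of the Rees algebra as syzygies of products. -/

section Relations

variable {K : Type*} [Field K] {n : ℕ} {ι : Type*} [Fintype ι] [DecidableEq ι]

variable (ι) in
/-- The exponent vectors of the monomials of degree `m` in variables indexed by `ι`. -/
abbrev Exponents (m : ℕ) : Type _ := ↥(Finset.finsuppAntidiag (Finset.univ : Finset ι) m)

theorem degree_of_mem_finsuppAntidiag {m : ℕ} {α : ι →₀ ℕ} :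
    α ∈ Finset.finsuppAntidiag (Finset.univ : Finset ι) m ↔ α.degree = m := by
  rw [Finset.mem_finsuppAntidiag, Finsupp.degree_eq_sum]
  simp

/-- The products of `m` members of the family `g`. -/
def powerProducts (g : ι → R K n) (m : ℕ) (α : Exponents ι m) : R K n :=
  ∏ e, g e ^ (α : ι →₀ ℕ) e

theorem powerProducts_isHomogeneous {g : ι → R K n} {D : ℕ} (hg : ∀ e, (g e).IsHomogeneous D)
    (m : ℕ) (α : Exponents ι m) : (powerProducts g m α).IsHomogeneous (D * m) := by
  have h1 : ∑ e, D * (α : ι →₀ ℕ) e = D * m := by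
    exact (Finset.mul_sum _ _ _).symm.trans
      (congrArg (D * ·) (Finset.mem_finsuppAntidiag.1 α.2).1)
  rw [← h1]
  exact IsHomogeneous.prod _ _ _ fun e _ => (hg e).pow _

theorem sum_monomial_coeff_of_isHomogeneous {m : ℕ} {F : MvPolynomial ι (R K n)}
    (hF : F.IsHomogeneous m) :
    ∑ α : Exponents ι m, monomial (α : ι →₀ ℕ) (F.coeff α) = F := by
  rw [Finset.sum_coe_sort (Finset.finsuppAntidiag (Finset.univ : Finset ι) m)
    (fun α => monomial α (F.coeff α))]
  conv_rhs => rw [← support_sum_monomial_coeff F]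
  symm
  refine Finset.sum_subset (fun α hα => degree_of_mem_finsuppAntidiag.2 ?_) fun α _ hα => ?_
  · exact (hF.degree_eq_sum_deg_support hα).symm
  · rw [notMem_support_iff.1 hα, monomial_zero]

theorem eval_of_isHomogeneous (g : ι → R K n) {m : ℕ} {F : MvPolynomial ι (R K n)}
    (hF : F.IsHomogeneous m) :
    eval g F = ∑ α : Exponents ι m, F.coeff α * powerProducts g m α := by
  conv_lhs => rw [← sum_monomial_coeff_of_isHomogeneous hF, map_sum]
  refine Finset.sum_congr rfl fun α _ => ?_
  rw [eval_monomial, powerProducts, Finsupp.prod_fintype _ _ (fun _ => pow_zero _)]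

theorem sum_monomial_isHomogeneous {m : ℕ} (v : Exponents ι m → R K n) :
    (∑ α : Exponents ι m, monomial (α : ι →₀ ℕ) (v α)).IsHomogeneous m :=
  IsHomogeneous.sum _ _ _ fun α _ =>
    isHomogeneous_monomial _ (degree_of_mem_finsuppAntidiag.1 α.2)

theorem coeff_sum_monomial {m : ℕ} (v : Exponents ι m → R K n) (α : Exponents ι m) :
    (∑ β : Exponents ι m, monomial (β : ι →₀ ℕ) (v β)).coeff α = v α := by
  rw [coeff_sum, Finset.sum_eq_single α]
  · rw [coeff_monomial, if_pos rfl]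
  · intro β _ hβ
    rw [coeff_monomial, if_neg fun h => hβ (Subtype.ext h)]
  · intro h
    exact absurd (Finset.mem_univ _) h

/-- Elements of the `m`-th power are the values at `g` of forms of degree `m` over `R`, and such a
form is a free choice of one coefficient per exponent vector. -/
theorem span_pow_eq_span_powerProducts (g : ι → R K n) (m : ℕ) :
    Ideal.span (Set.range g) ^ m = Ideal.span (Set.range (powerProducts g m)) := by
  ext q
  rw [Ideal.mem_span_pow_iff_exists_isHomogeneous, Ideal.mem_span_range_iff_exists_fun]
  constructor
  · rintro ⟨F, hF, rfl⟩
    exact ⟨_, (eval_of_isHomogeneous g hF).symm⟩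
  · rintro ⟨v, rfl⟩
    refine ⟨_, sum_monomial_isHomogeneous v, ?_⟩
    rw [eval_of_isHomogeneous g (sum_monomial_isHomogeneous v)]
    simp only [coeff_sum_monomial]

/-- The image sits in a single power of `T`, so being a relation reduces to vanishing at `g`. -/
theorem coe_reesMap_of_isHomogeneous {I : Ideal (R K n)} {g : ι → R K n} (hg : ∀ e, g e ∈ I)
    {m : ℕ} {F : MvPolynomial ι (R K n)} (hF : F.IsHomogeneous m) :
    (reesMap I g hg F : Polynomial (R K n)) = Polynomial.monomial m (eval g F) := by
  have h1 : ((reesAlgebra I).val.comp (reesMap I g hg)) =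
      aeval (fun e => Polynomial.monomial 1 (g e)) := by
    apply algHom_ext
    intro e
    simp [reesMap]
  have h2 : (reesMap I g hg F : Polynomial (R K n)) =
      aeval (fun e => Polynomial.monomial 1 (g e)) F := by
    rw [← h1]
    rfl
  rw [h2, eval_of_isHomogeneous g hF]
  conv_lhs => rw [← sum_monomial_coeff_of_isHomogeneous hF, map_sum]
  rw [map_sum]
  refine Finset.sum_congr rfl fun α _ => ?_
  rw [aeval_monomial, powerProducts, Finsupp.prod_fintype _ _ (fun _ => pow_zero _)]
  have h3 : ∏ e, (Polynomial.monomial 1 (g e)) ^ (α : ι →₀ ℕ) e =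
      Polynomial.monomial m (∏ e, g e ^ (α : ι →₀ ℕ) e) := by
    simp only [mul_pow, Finset.prod_mul_distrib,
      Finset.prod_pow_eq_pow_sum, ← Polynomial.C_mul_X_pow_eq_monomial, map_prod, map_pow, pow_one]
    rw [(Finset.mem_finsuppAntidiag.1 α.2).1]
  rw [h3, ← Polynomial.C_eq_algebraMap, Polynomial.C_mul_monomial]

theorem mem_relationsOfDegree {I : Ideal (R K n)} {g : ι → R K n} (hg : ∀ e, g e ∈ I) {m : ℕ}
    {F : MvPolynomial ι (R K n)} :
    F ∈ relationsOfDegree (reesRelations I g hg) m ↔ eval g F = 0 ∧ F.IsHomogeneous m := by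
  rw [relationsOfDegree, Submodule.mem_inf, mem_homogeneousSubmodule]
  refine and_congr_left fun hF => ?_
  rw [Submodule.restrictScalars_mem, reesRelations, RingHom.mem_ker, ← ZeroMemClass.coe_eq_zero]
  change (reesMap I g hg F : Polynomial (R K n)) = 0 ↔ _
  rw [coe_reesMap_of_isHomogeneous hg hF, Polynomial.monomial_eq_zero_iff]

/-- The relations of degree `m` in the variables `T_e` are the syzygies of the products of `m`
generators. -/
def relationsEquivSyzygies {I : Ideal (R K n)} {g : ι → R K n} (hg : ∀ e, g e ∈ I) (m : ℕ) :
    relationsOfDegree (reesRelations I g hg) m ≃ₗ[R K n]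
      LinearMap.ker (Fintype.linearCombination (R K n) (powerProducts g m)) where
  toFun F := ⟨fun α => (F : MvPolynomial ι (R K n)).coeff α, by
    have hF := (mem_relationsOfDegree hg).1 F.2
    rw [LinearMap.mem_ker, Fintype.linearCombination_apply]
    simpa only [smul_eq_mul, eval_of_isHomogeneous g hF.2] using hF.1⟩
  map_add' F F' := by
    ext1
    funext α
    simp
  map_smul' r F := by
    ext1
    funext α
    simp
  invFun v := ⟨∑ α : Exponents ι m, monomial (α : ι →₀ ℕ) ((v : Exponents ι m → R K n) α), by
    refine (mem_relationsOfDegree hg).2 ⟨?_, sum_monomial_isHomogeneous _⟩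
    rw [eval_of_isHomogeneous g (sum_monomial_isHomogeneous _)]
    have hv := v.2
    rw [LinearMap.mem_ker, Fintype.linearCombination_apply] at hv
    simpa only [coeff_sum_monomial, smul_eq_mul] using hv⟩
  left_inv F := Subtype.ext <|
    sum_monomial_coeff_of_isHomogeneous ((mem_relationsOfDegree hg).1 F.2).2
  right_inv v := Subtype.ext <| funext fun α => coeff_sum_monomial _ α

/-- If the products of `m` members of a family of quadrics are linearly independent, then the
relations of degree `m` form the first syzygy module of the `m`-th power of the ideal. -/
theorem gradedIsoSyzygy_of_linearIndependent {I : Ideal (R K n)} {g : ι → R K n}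
    (hg : ∀ e, g e ∈ I) (hI : I = Ideal.span (Set.range g)) (h2 : ∀ e, (g e).IsHomogeneous 2)
    {m : ℕ} (hli : LinearIndependent K (powerProducts g m)) :
    GradedIsoSyzygy (reesRelations I g hg) m (I ^ m) := by
  have hpow : I ^ m = Ideal.span (Set.range (powerProducts g m)) := by
    rw [hI, span_pow_eq_span_powerProducts]
  rw [hpow]
  have hD := powerProducts_isHomogeneous h2 m
  refine ⟨⟨MinimalCover.ofLinearIndependent hD hli⟩, fun P => ?_⟩
  obtain ⟨e, he⟩ := exists_ker_equiv_syzygy hD hli P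
  refine ⟨(relationsEquivSyzygies hg m).trans e, fun F b => ?_⟩
  rw [LinearEquiv.trans_apply, ← he]
  have hF := ((mem_relationsOfDegree hg).1 F.2).2
  -- The shift `2 * m` in the bidegree is the common degree of the products, so the conditions agree
  -- coefficient by coefficient; zero coefficients impose none.
  constructor
  · intro hb α d hd
    by_cases hα : (α : ι →₀ ℕ) ∈ (F : MvPolynomial ι (R K n)).support
    · exact (hb α hα).2 d hd
    · have h0 : (F : MvPolynomial ι (R K n)).coeff α = 0 := notMem_support_iff.1 hα
      exact absurd (congrArg (coeff d) h0) (mem_support_iff.1 hd)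
  · intro hb α hα
    have hdeg : α.degree = m := (hF.degree_eq_sum_deg_support hα).symm
    exact ⟨hdeg, hb ⟨α, degree_of_mem_finsuppAntidiag.2 hdeg⟩⟩

end Relations

/-! ### Linear independence of products via leading monomials. -/

section Independence

variable {K : Type*} [Field K] {n : ℕ}

/-- The largest leading monomial occurring with nonzero coefficient in a relation appears in no
other term, so it cannot cancel. -/
theorem linearIndependent_of_degree_injective {σ κ : Type*} [Fintype κ] (m : MonomialOrder σ)
    {h : κ → MvPolynomial σ K} (h0 : ∀ k, h k ≠ 0)
    (hinj : Function.Injective fun k => m.degree (h k)) : LinearIndependent K h := by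
  classical
  rw [Fintype.linearIndependent_iff]
  intro c hc
  by_contra! hne
  obtain ⟨i, hi⟩ := hne
  obtain ⟨k, hk, hmax⟩ := Finset.exists_max_image (Finset.univ.filter fun k => c k ≠ 0)
    (fun k => m.toSyn (m.degree (h k))) ⟨i, by simpa using hi⟩
  have h1 := congrArg (coeff (m.degree (h k))) hc
  rw [coeff_sum, Finset.sum_eq_single k, coeff_smul, smul_eq_mul, coeff_zero] at h1
  · exact (mul_ne_zero (Finset.mem_filter.1 hk).2 (m.coeff_degree_ne_zero_iff.2 (h0 k))) h1
  · intro l _ hl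
    rw [coeff_smul, smul_eq_mul]
    by_cases hcl : c l = 0
    · rw [hcl, zero_mul]
    · rw [m.coeff_eq_zero_of_lt, mul_zero]
      refine lt_of_le_of_ne (hmax l (by simpa using hcl)) fun heq => hl ?_
      exact hinj (m.toSyn.injective heq)
  · intro hk
    exact absurd (Finset.mem_univ _) hk

/-- The exponent vector of `x_i y_j`. -/
def edgeExp (i j : Fin n) : Var n →₀ ℕ :=
  Finsupp.single (Sum.inlₗ i) 1 + Finsupp.single (Sum.inrₗ j) 1

theorem x_mul_y_eq_monomial (i j : Fin n) : x K i * y K j = monomial (edgeExp i j) 1 := by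
  rw [x, y, X, X, monomial_mul, edgeExp, mul_one]

theorem f_eq_monomial_sub_monomial (i j : Fin n) :
    f K i j = monomial (edgeExp i j) 1 - monomial (edgeExp j i) 1 := by
  rw [f, x_mul_y_eq_monomial, x_mul_y_eq_monomial]

theorem edgeExp_apply_inl (i j k : Fin n) :
    edgeExp i j (Sum.inlₗ k) = if i = k then 1 else 0 := by
  simp [edgeExp, Finsupp.single_apply]

theorem edgeExp_apply_inr (i j k : Fin n) :
    edgeExp i j (Sum.inrₗ k) = if j = k then 1 else 0 := by
  simp [edgeExp, Finsupp.single_apply]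

theorem edgeExp_degree (i j : Fin n) : (edgeExp i j).degree = 2 := by
  simp [edgeExp]

theorem f_isHomogeneous (i j : Fin n) : (f K i j).IsHomogeneous 2 := by
  rw [f_eq_monomial_sub_monomial]
  exact (isHomogeneous_monomial _ (edgeExp_degree i j)).sub
    (isHomogeneous_monomial _ (edgeExp_degree j i))

theorem edgeExp_swap_lt {i j : Fin n} (h : i < j) :
    MonomialOrder.lex.toSyn (edgeExp j i) < MonomialOrder.lex.toSyn (edgeExp i j) := by
  rw [MonomialOrder.lex_lt_iff, Finsupp.Lex.lt_iff]
  refine ⟨Sum.inlₗ i, fun v hv => ?_, ?_⟩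
  · rcases v with k | k
    · have hk : k < i := Sum.Lex.inl_lt_inl_iff.1 hv
      change edgeExp j i (Sum.inlₗ k) = edgeExp i j (Sum.inlₗ k)
      rw [edgeExp_apply_inl, edgeExp_apply_inl, if_neg (by omega), if_neg (by omega)]
    · exact absurd hv Sum.Lex.not_inr_lt_inl
  · change edgeExp j i (Sum.inlₗ i) < edgeExp i j (Sum.inlₗ i)
    rw [edgeExp_apply_inl, edgeExp_apply_inl, if_neg h.ne', if_pos rfl]
    exact Nat.zero_lt_one

theorem degree_monomial_one (d : Var n →₀ ℕ) :
    MonomialOrder.lex.degree (monomial d (1 : K)) = d := by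
  classical
  rw [MonomialOrder.degree_monomial, if_neg one_ne_zero]

theorem degree_f {i j : Fin n} (h : i < j) :
    MonomialOrder.lex.degree (f K i j) = edgeExp i j := by
  rw [f_eq_monomial_sub_monomial, MonomialOrder.degree_sub_of_lt, degree_monomial_one]
  rw [degree_monomial_one, degree_monomial_one]
  exact edgeExp_swap_lt h

theorem f_swap (i j : Fin n) : f K i j = -f K j i := by
  rw [f, f, neg_sub]

theorem degree_f_of_ne {i j : Fin n} (h : i ≠ j) :
    MonomialOrder.lex.degree (f K i j) = edgeExp (min i j) (max i j) := by
  rcases lt_or_gt_of_ne h with hlt | hlt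
  · rw [degree_f hlt, min_eq_left hlt.le, max_eq_right hlt.le]
  · rw [f_swap, MonomialOrder.degree_neg, degree_f hlt, min_eq_right hlt.le, max_eq_left hlt.le]

theorem edgeExp_ne_zero (i j : Fin n) : edgeExp i j ≠ 0 := by
  intro h
  have := edgeExp_degree i j
  rw [h] at this
  simp at this

theorem exists_ne_of_sum_eq_zero {ι : Type*} {s : Finset ι} {γ : ι → ℤ} (hs : ∑ e ∈ s, γ e = 0)
    {e : ι} (he : e ∈ s) (h0 : γ e ≠ 0) : ∃ e' ∈ s, e' ≠ e ∧ γ e' ≠ 0 := by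
  by_contra! hc
  rw [Finset.sum_eq_single_of_mem e he hc] at hs
  exact h0 hs

theorem not_cliqueFree_four {V : Type*} {G : SimpleGraph V} {a b c d : V} (hab : G.Adj a b)
    (hac : G.Adj a c) (had : G.Adj a d) (hbc : G.Adj b c) (hbd : G.Adj b d) (hcd : G.Adj c d) :
    ¬ G.CliqueFree 4 := by
  classical
  intro h
  refine h (insert a {b, c, d})
    ((SimpleGraph.is3Clique_triple_iff.2 ⟨hbc, hbd, hcd⟩).insert ?_)
  intro v hv
  simp only [Finset.mem_insert, Finset.mem_singleton] at hv
  rcases hv with rfl | rfl | rfl <;> assumption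

/-- For a closed labeling without `K_4`, an integer weighting of the edges all of whose row sums
(over the smaller end point) and column sums (over the larger end point) vanish is zero: the
bipartite graph with edges `x_i y_j` is a forest. -/
theorem weight_eq_zero {ι : Type*} [Fintype ι] {H : SimpleGraph (Fin n)}
    (hH : IsClosedLabeling H) (hfree : H.CliqueFree 4) {a b : ι → Fin n}
    (hinj : ∀ e e', a e = a e' → b e = b e' → e = e') (hlt : ∀ e, a e < b e)
    (hadj : ∀ e, H.Adj (a e) (b e)) {γ : ι → ℤ}
    (hrow : ∀ i, ∑ e with a e = i, γ e = 0) (hcol : ∀ j, ∑ e with b e = j, γ e = 0) : γ = 0 := by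
  classical
  by_contra hne
  obtain ⟨e₁, he₁⟩ := Function.ne_iff.1 hne
  obtain ⟨e₀, he₀, hmin⟩ := Finset.exists_min_image (Finset.univ.filter fun e => γ e ≠ 0) a
    ⟨e₁, by simpa using he₁⟩
  replace he₀ : γ e₀ ≠ 0 := by simpa using he₀
  replace hmin (e : ι) (he : γ e ≠ 0) : a e₀ ≤ a e := hmin e (by simpa using he)
  -- two edges of the support with minimal smaller end point, ordered by their larger end point
  obtain ⟨e, e', he, haa, hmine, hbb⟩ : ∃ e e', γ e ≠ 0 ∧ a e = a e' ∧
      (∀ d, γ d ≠ 0 → a e ≤ a d) ∧ b e < b e' := by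
    obtain ⟨e', he', hne', h0'⟩ := exists_ne_of_sum_eq_zero (hrow (a e₀)) (e := e₀) (by simp) he₀
    have haa : a e' = a e₀ := by simpa using he'
    rcases lt_trichotomy (b e₀) (b e') with h | h | h
    · exact ⟨e₀, e', he₀, haa.symm, hmin, h⟩
    · exact absurd (hinj _ _ haa h.symm) hne'
    · exact ⟨e', e₀, h0', haa, haa ▸ hmin, h⟩
  -- Cancellation in the column of the shorter edge gives `d`, and minimality gives `a e < a d < b e
  -- < b e'`. Closedness then makes these four vertices a clique.
  obtain ⟨d, hd, hned, h0d⟩ := exists_ne_of_sum_eq_zero (hcol (b e)) (e := e) (by simp) he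
  have hbd : b d = b e := by simpa using hd
  have had : a e < a d := lt_of_le_of_ne (hmine d h0d) fun h => hned (hinj _ _ h.symm hbd)
  have h1 : H.Adj (a e) (a d) :=
    (hH _ _ _ _ (hadj e) (hadj d) (hlt e) (hlt d)).2 hbd.symm had.ne
  have h2 : H.Adj (b e) (b e') :=
    (hH _ _ _ _ (hadj e) (hadj e') (hlt e) (hlt e')).1 haa hbb.ne
  have h3 : H.Adj (a e) (b e') := haa ▸ hadj e'
  have hde : a d < b e := hbd ▸ hlt d
  have h4 : H.Adj (a d) (b e') :=
    (hH _ _ _ _ h1 h3 had (haa ▸ hlt e')).1 rfl (hde.trans hbb).ne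
  exact not_cliqueFree_four h1 (hadj e) h3 (hbd ▸ hadj d) h4 h2 hfree

/-- For a closed labeling without `K_4`, the monomials `x_i y_j` are algebraically independent. -/
theorem sum_edgeExp_injective {ι : Type*} [Fintype ι] {H : SimpleGraph (Fin n)}
    (hH : IsClosedLabeling H) (hfree : H.CliqueFree 4) {a b : ι → Fin n}
    (hinj : ∀ e e', a e = a e' → b e = b e' → e = e') (hlt : ∀ e, a e < b e)
    (hadj : ∀ e, H.Adj (a e) (b e)) {α β : ι →₀ ℕ}
    (hαβ : ∑ e, α e • edgeExp (a e) (b e) = ∑ e, β e • edgeExp (a e) (b e)) : α = β := by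
  -- Comparing exponents of `x_i` gives the row sums, and exponents of `y_j` the column sums.
  have hγ : (fun e => (α e : ℤ) - β e) = 0 := by
    refine weight_eq_zero hH hfree hinj hlt hadj (fun i => ?_) fun j => ?_
    · have h1 := DFunLike.congr_fun hαβ (Sum.inlₗ i)
      simp only [Finsupp.finsetSum_apply, Finsupp.smul_apply, edgeExp_apply_inl, smul_eq_mul,
        mul_ite, mul_one, mul_zero, ← Finset.sum_filter] at h1
      rw [Finset.sum_sub_distrib, sub_eq_zero]
      exact_mod_cast h1
    · have h1 := DFunLike.congr_fun hαβ (Sum.inrₗ j)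
      simp only [Finsupp.finsetSum_apply, Finsupp.smul_apply, edgeExp_apply_inr, smul_eq_mul,
        mul_ite, mul_one, mul_zero, ← Finset.sum_filter] at h1
      rw [Finset.sum_sub_distrib, sub_eq_zero]
      exact_mod_cast h1
  ext e
  have := congrFun hγ e
  simp only [Pi.zero_apply] at this
  omega

/-- Leading monomials multiply, so only those of the `g e` matter. The same argument therefore
serves the binomials and their initial monomials. -/
theorem linearIndependent_powerProducts {ι : Type*} [Fintype ι] [DecidableEq ι]
    {H : SimpleGraph (Fin n)} (hH : IsClosedLabeling H) (hfree : H.CliqueFree 4)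
    {a b : ι → Fin n} (hinj : ∀ e e', a e = a e' → b e = b e' → e = e')
    (hlt : ∀ e, a e < b e) (hadj : ∀ e, H.Adj (a e) (b e)) {g : ι → R K n}
    (hdeg : ∀ e, MonomialOrder.lex.degree (g e) = edgeExp (a e) (b e)) (m : ℕ) :
    LinearIndependent K (powerProducts g m) := by
  have h0 (e : ι) : g e ≠ 0 := by
    intro h
    have := hdeg e
    rw [h, MonomialOrder.degree_zero] at this
    exact edgeExp_ne_zero _ _ this.symm
  refine linearIndependent_of_degree_injective MonomialOrder.lex
    (fun α => Finset.prod_ne_zero_iff.2 fun e _ => pow_ne_zero _ (h0 e)) fun α β hαβ => ?_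
  refine Subtype.ext (sum_edgeExp_injective hH hfree hinj hlt hadj ?_)
  simpa only [powerProducts, MonomialOrder.degree_prod fun e _ => pow_ne_zero _ (h0 e),
    MonomialOrder.degree_pow, hdeg] using hαβ

/-- The action of a map of vertices on the variables. -/
def varMap (φ : Fin n → Fin n) (v : Var n) : Var n := toLex (Sum.map φ φ (ofLex v))

theorem rename_f (φ : Fin n → Fin n) (i j : Fin n) :
    rename (varMap φ) (f K i j) = f K (φ i) (φ j) := by
  simp only [f, x, y, map_sub, map_mul, rename_X]
  rfl

/-- Renaming variables along `φ` sends the generators to edge binomials of `H`, up to sign, and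
independence of the images gives independence of the originals. Since `φ` may reverse an edge, end
points are taken as `min` and `max`. -/
theorem linearIndependent_powerProducts_edgeGen {G H : SimpleGraph (Fin n)} (φ : G ≃g H)
    (hH : IsClosedLabeling H) (hfree : H.CliqueFree 4) [Fintype (Edge G)] [DecidableEq (Edge G)]
    (m : ℕ) : LinearIndependent K (powerProducts (edgeGen K G) m) := by
  have hne (e : Edge G) : φ e.1.1 ≠ φ e.1.2 := φ.injective.ne e.2.1.ne
  have hadj (e : Edge G) : H.Adj (φ e.1.1) (φ e.1.2) := φ.map_adj_iff.2 e.2.2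
  have hli : LinearIndependent K
      (powerProducts (fun e : Edge G => f K (φ e.1.1) (φ e.1.2)) m) := by
    refine linearIndependent_powerProducts hH hfree
      (a := fun e : Edge G => min (φ e.1.1) (φ e.1.2))
      (b := fun e : Edge G => max (φ e.1.1) (φ e.1.2)) ?_ ?_ ?_ ?_ m
    · rintro ⟨⟨i, j⟩, hij, _⟩ ⟨⟨k, l⟩, hkl, _⟩ hmin hmax
      have key : (φ i = φ k ∧ φ j = φ l) ∨ (φ i = φ l ∧ φ j = φ k) := by
        change min (φ i) (φ j) = min (φ k) (φ l) at hmin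
        change max (φ i) (φ j) = max (φ k) (φ l) at hmax
        grind
      rcases key with ⟨h1, h2⟩ | ⟨h1, h2⟩
      · simp [φ.injective h1, φ.injective h2]
      · rw [φ.injective h1, φ.injective h2] at hij
        exact absurd hij hkl.not_gt
    · exact fun e => min_lt_max.2 (hne e)
    · intro e
      rcases le_total (φ e.1.1) (φ e.1.2) with h | h
      · simpa only [min_eq_left h, max_eq_right h] using hadj e
      · simpa only [min_eq_right h, max_eq_left h] using (hadj e).symm
    · exact fun e => degree_f_of_ne (hne e)
  refine LinearIndependent.of_comp (rename (varMap φ)).toLinearMap ?_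
  have hcomp : (rename (varMap φ)).toLinearMap ∘ powerProducts (edgeGen K G) m =
      powerProducts (fun e : Edge G => f K (φ e.1.1) (φ e.1.2)) m := by
    funext α
    simp [powerProducts, edgeGen, rename_f]
  exact hcomp ▸ hli

end Independence

/-! ### The quadratic Gröbner basis via confluent rewriting. -/

section Groebner

variable {K : Type*} [Field K] {n : ℕ}

/-- Reduction of monomials modulo the generators of the binomial edge ideal: a factor `x_i y_j`
with `{i, j}` an edge and `i < j` is replaced by `x_j y_i`. -/
def Step (H : SimpleGraph (Fin n)) (u v : Var n →₀ ℕ) : Prop :=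
  ∃ w i j, i < j ∧ H.Adj i j ∧ u = w + edgeExp i j ∧ v = w + edgeExp j i

theorem Step.lt {H : SimpleGraph (Fin n)} {u v : Var n →₀ ℕ} (h : Step H u v) :
    MonomialOrder.lex.toSyn v < MonomialOrder.lex.toSyn u := by
  obtain ⟨w, i, j, hij, -, rfl, rfl⟩ := h
  rw [map_add, map_add]
  exact add_lt_add_right (edgeExp_swap_lt hij) _

theorem le_of_reflTransGen_step {H : SimpleGraph (Fin n)} {u v : Var n →₀ ℕ}
    (h : Relation.ReflTransGen (Step H) u v) :
    MonomialOrder.lex.toSyn v ≤ MonomialOrder.lex.toSyn u := by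
  induction h with
  | refl => exact le_rfl
  | tail _ h ih => exact h.lt.le.trans ih

theorem exists_common_of_add_single_eq {σ : Type*} {a b : σ →₀ ℕ} {p q : σ} (hpq : p ≠ q)
    (h : a + Finsupp.single p 1 = b + Finsupp.single q 1) :
    ∃ w, a = w + Finsupp.single q 1 ∧ b = w + Finsupp.single p 1 := by
  classical
  have hle : Finsupp.single q 1 ≤ a := by
    rw [Finsupp.single_le_iff]
    have := DFunLike.congr_fun h q
    simp only [Finsupp.add_apply, Finsupp.single_eq_same, Finsupp.single_eq_of_ne hpq.symm] at this
    omega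
  obtain ⟨w, rfl⟩ := exists_add_of_le hle
  refine ⟨w, add_comm _ _, ?_⟩
  apply add_right_cancel (b := Finsupp.single q 1)
  rw [← h]
  abel

/-- If the two replaced factors share one variable, closedness supplies an edge between the other
two indices, and one step along it joins the results. If they share none, the steps commute. The
asymmetric conclusion is the hypothesis of `Relation.equivalence_join_reflTransGen`. -/
theorem step_diamond {H : SimpleGraph (Fin n)} (hH : IsClosedLabeling H) (u v v' : Var n →₀ ℕ)
    (hv : Step H u v) (hv' : Step H u v') :
    ∃ d, Relation.ReflGen (Step H) v d ∧ Relation.ReflTransGen (Step H) v' d := by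
  obtain ⟨w₁, i, j, hij, hadj, rfl, rfl⟩ := hv
  obtain ⟨w₂, k, l, hkl, hadj', heq, rfl⟩ := hv'
  by_cases hik : i = k
  · subst hik
    by_cases hjl : j = l
    · subst hjl
      rw [add_right_cancel heq]
      exact ⟨_, .refl, .refl⟩
    · have hA : H.Adj j l := (hH _ _ _ _ hadj hadj' hij hkl).1 rfl hjl
      have h1 : w₁ + Finsupp.single (Sum.inrₗ j) 1 = w₂ + Finsupp.single (Sum.inrₗ l) 1 := by
        apply add_right_cancel (b := Finsupp.single (Sum.inlₗ i) 1)
        rw [edgeExp, edgeExp] at heq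
        rw [add_assoc, add_assoc, add_comm (Finsupp.single (Sum.inrₗ j) 1),
          add_comm (Finsupp.single (Sum.inrₗ l) 1), heq]
      obtain ⟨w, rfl, rfl⟩ := exists_common_of_add_single_eq (by simpa using hjl) h1
      rcases lt_or_gt_of_ne hjl with hlt | hlt
      · refine ⟨_, .single ⟨w + Finsupp.single (Sum.inrₗ i) 1, j, l, hlt, hA, ?_, rfl⟩, ?_⟩
        · simp only [edgeExp]; abel
        · convert Relation.ReflTransGen.refl using 1
          simp only [edgeExp]; abel
      · refine ⟨_, .refl, .single ⟨w + Finsupp.single (Sum.inrₗ i) 1, l, j, hlt, hA.symm, ?_, ?_⟩⟩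
        · simp only [edgeExp]; abel
        · simp only [edgeExp]; abel
  · by_cases hjl : j = l
    · subst hjl
      have hA : H.Adj i k := (hH _ _ _ _ hadj hadj' hij hkl).2 rfl hik
      have h1 : w₁ + Finsupp.single (Sum.inlₗ i) 1 = w₂ + Finsupp.single (Sum.inlₗ k) 1 := by
        apply add_right_cancel (b := Finsupp.single (Sum.inrₗ j) 1)
        rw [edgeExp, edgeExp] at heq
        rw [add_assoc, add_assoc, heq]
      obtain ⟨w, rfl, rfl⟩ := exists_common_of_add_single_eq (by simpa using hik) h1
      rcases lt_or_gt_of_ne hik with hlt | hlt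
      · refine ⟨_, .refl, .single ⟨w + Finsupp.single (Sum.inlₗ j) 1, i, k, hlt, hA, ?_, ?_⟩⟩
        · simp only [edgeExp]; abel
        · simp only [edgeExp]; abel
      · refine ⟨_, .single ⟨w + Finsupp.single (Sum.inlₗ j) 1, k, i, hlt, hA.symm, ?_, rfl⟩, ?_⟩
        · simp only [edgeExp]; abel
        · convert Relation.ReflTransGen.refl using 1
          simp only [edgeExp]; abel
    · have h1 : (w₁ + Finsupp.single (Sum.inrₗ j) 1) + Finsupp.single (Sum.inlₗ i) 1 =
          (w₂ + Finsupp.single (Sum.inrₗ l) 1) + Finsupp.single (Sum.inlₗ k) 1 := by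
        rw [edgeExp, edgeExp] at heq
        rw [add_assoc, add_assoc, add_comm (Finsupp.single (Sum.inrₗ j) 1),
          add_comm (Finsupp.single (Sum.inrₗ l) 1), heq]
      obtain ⟨w, h2, h3⟩ := exists_common_of_add_single_eq (by simpa using hik) h1
      obtain ⟨w', rfl, rfl⟩ := exists_common_of_add_single_eq (by simp) h2
      have h4 : w₂ + Finsupp.single (Sum.inrₗ l) 1 =
          (w' + Finsupp.single (Sum.inlₗ i) 1) + Finsupp.single (Sum.inrₗ j) 1 := by
        rw [h3]; abel
      obtain ⟨z, rfl, h5⟩ := exists_common_of_add_single_eq (by simpa using Ne.symm hjl) h4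
      obtain ⟨z', rfl, rfl⟩ := exists_common_of_add_single_eq (by simp) h5
      refine ⟨z' + edgeExp j i + edgeExp l k,
        .single ⟨z' + edgeExp j i, k, l, hkl, hadj', ?_, rfl⟩,
        .single ⟨z' + edgeExp l k, i, j, hij, hadj, ?_, ?_⟩⟩
      · simp only [edgeExp]; abel
      · simp only [edgeExp]; abel
      · abel

/-- Summing coefficients over a rewriting class is a functional that kills the ideal. Were the
leading monomial irreducible, it would be the least in its class by confluence, so the functional
would return the nonzero leading coefficient. -/
theorem exists_step_of_mem_J {H : SimpleGraph (Fin n)} (hH : IsClosedLabeling H) {p : R K n}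
    (hp : p ∈ J K H) (hp0 : p ≠ 0) : ∃ v, Step H (MonomialOrder.lex.degree p) v := by
  classical
  by_contra! hirr
  set μ := MonomialOrder.lex.degree p with hμ
  have hequiv := Relation.equivalence_join_reflTransGen (step_diamond hH)
  -- the sum of the coefficients of the monomials equivalent to `μ`
  let Λ : R K n →ₗ[K] K := (basisMonomials (Var n) K).constr K
    fun ν => if Relation.Join (Relation.ReflTransGen (Step H)) ν μ then 1 else 0
  have hΛ (ν : Var n →₀ ℕ) (c : K) : Λ (monomial ν c) =
      if Relation.Join (Relation.ReflTransGen (Step H)) ν μ then c else 0 := by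
    have h1 : monomial ν c = c • basisMonomials (Var n) K ν := by
      rw [coe_basisMonomials, smul_monomial, smul_eq_mul, mul_one]
    rw [h1, map_smul, Module.Basis.constr_basis]
    simp
  have hstep {u v : Var n →₀ ℕ} (h : Step H u v) (c : K) :
      Λ (monomial u c) = Λ (monomial v c) := by
    have huv : Relation.Join (Relation.ReflTransGen (Step H)) u v := ⟨v, .single h, .refl⟩
    rw [hΛ, hΛ]
    exact if_congr ⟨fun h' => hequiv.trans (hequiv.symm huv) h', fun h' => hequiv.trans huv h'⟩
      rfl rfl
  have hker (q : R K n) (e : Edge H) : Λ (q * edgeGen K H e) = 0 := by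
    induction q using MvPolynomial.induction_on' with
    | monomial w c =>
      rw [edgeGen, f_eq_monomial_sub_monomial, mul_sub, monomial_mul, monomial_mul, map_sub,
        mul_one, sub_eq_zero]
      exact hstep ⟨w, _, _, e.2.1, e.2.2, rfl, rfl⟩ c
    | add p q hp hq => rw [add_mul, map_add, hp, hq, add_zero]
  have hzero : Λ p = 0 := by
    -- `Λ` is only `K`-linear, so the induction carries all multiples `r * q`.
    refine Submodule.span_induction (p := fun q _ => ∀ r : R K n, Λ (r * q) = 0) ?_ ?_ ?_ ?_ hp 1
      |> fun h => by rwa [one_mul] at h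
    · rintro _ ⟨e, rfl⟩ r
      exact hker r e
    · intro r
      rw [mul_zero, map_zero]
    · intro q q' _ _ hq hq' r
      rw [mul_add, map_add, hq, hq', add_zero]
    · intro s q _ hq r
      rw [smul_eq_mul, ← mul_assoc]
      exact hq _
  have hsum : Λ p = p.coeff μ := by
    conv_lhs => rw [← support_sum_monomial_coeff p, map_sum]
    rw [Finset.sum_eq_single μ]
    · rw [hΛ, if_pos (hequiv.refl μ)]
    · intro ν hν hne
      rw [hΛ, if_neg]
      rintro ⟨d, hνd, hμd⟩
      -- Irreducibility of `μ` leaves only `d = μ`. Then `ν` reduces to `μ`, so `μ ≤ ν`, while `ν ≤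
      -- μ` as `ν` lies in the support of `p`.
      rcases Relation.ReflTransGen.cases_head hμd with rfl | ⟨v, hv, -⟩
      · refine hne (MonomialOrder.lex.toSyn.injective (le_antisymm ?_ ?_))
        · exact MonomialOrder.lex.le_degree hν
        · exact le_of_reflTransGen_step hνd
      · exact hirr v hv
    · intro h
      rw [notMem_support_iff.1 h, map_zero, map_zero]
  rw [hsum] at hzero
  exact MonomialOrder.lex.coeff_degree_ne_zero_iff.2 hp0 hzero

theorem edgeInitial_eq_monomial (H : SimpleGraph (Fin n)) (e : Edge H) :
    edgeInitial K H e = monomial (edgeExp e.1.1 e.1.2) 1 := by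
  rw [edgeInitial, leadMonomial, edgeGen, degree_f e.2.1]

/-- The generators of the binomial edge ideal of a closed labeling are a Gröbner basis. -/
theorem initialIdeal_J_eq_span {H : SimpleGraph (Fin n)} (hH : IsClosedLabeling H) :
    initialIdeal (J K H) = Ideal.span (Set.range (edgeInitial K H)) := by
  apply le_antisymm
  · rw [initialIdeal, Ideal.span_le]
    rintro _ ⟨p, hp, hp0, rfl⟩
    -- A reducible monomial is divisible by the initial monomial of an edge.
    obtain ⟨-, w, i, j, hij, hadj, hw, -⟩ := exists_step_of_mem_J hH hp hp0
    have h1 : leadMonomial p = monomial w 1 * edgeInitial K H ⟨(i, j), hij, hadj⟩ := by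
      rw [leadMonomial, hw, edgeInitial_eq_monomial, monomial_mul, one_mul]
    rw [h1]
    exact Ideal.mul_mem_left _ _ (Ideal.subset_span ⟨_, rfl⟩)
  · rw [Ideal.span_le]
    rintro _ ⟨e, rfl⟩
    exact edgeInitial_mem K H e

end Groebner

end BinomialEdge

end

/-! ### The main theorem. -/

open BinomialEdge in
theorem corollary3p4 {K : Type*} [Field K] {n : ℕ} (G : SimpleGraph (Fin n))
    (hG : IsClosedGraph G)
    (hK4 : ¬ (⊤ : SimpleGraph (Fin 4)).IsIndContained G) :
    (∀ m : ℕ, 1 ≤ m →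
      GradedIsoSyzygy (reesRelations (J K G) (edgeGen K G) (edgeGen_mem K G)) m (J K G ^ m)) ∧
    (∀ H : SimpleGraph (Fin n), Nonempty (G ≃g H) → IsClosedLabeling H → ∀ m : ℕ, 1 ≤ m →
      GradedIsoSyzygy
        (reesRelations (initialIdeal (J K H)) (edgeInitial K H) (edgeInitial_mem K H)) m
        (initialIdeal (J K H) ^ m)) := by
  classical
  have hfree {H : SimpleGraph (Fin n)} (φ : G ≃g H) : H.CliqueFree 4 := by
    by_contra h
    exact hK4 ⟨φ.symm.toEmbedding.comp (SimpleGraph.topEmbeddingOfNotCliqueFree h)⟩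
  constructor
  · intro m _
    obtain ⟨H, ⟨φ⟩, hH⟩ := hG
    exact gradedIsoSyzygy_of_linearIndependent _ rfl (fun e => f_isHomogeneous _ _)
      (linearIndependent_powerProducts_edgeGen φ hH (hfree φ) m)
  · rintro H ⟨φ⟩ hH m _
    refine gradedIsoSyzygy_of_linearIndependent _ (initialIdeal_J_eq_span hH) (fun e => ?_)
      (linearIndependent_powerProducts hH (hfree φ) (a := fun e : Edge H => e.1.1)
        (b := fun e => e.1.2) (fun e e' h h' => Subtype.ext (Prod.ext h h')) (fun e => e.2.1)
        (fun e => e.2.2) (fun e => ?_) m)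
    · rw [edgeInitial_eq_monomial]
      exact isHomogeneous_monomial _ (edgeExp_degree _ _)
    · rw [edgeInitial_eq_monomial, degree_monomial_one]
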